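/- **Setting.** Let $S$, $A\neq\emptyset$, $O$ be finite sets of states, actions and observations, with transition probabilities $T(s'\mid s,\alpha)$, observation probabilities $O(o\mid s,\alpha)$ ($s$ being the state reached under $\alpha$) and costs $c(s,\alpha)\ge 0$ (bounded, as the sets are finite). Let $\Delta(S)$ be the set of probability vectors on $S$. For $b\in\Delta(S)$, $\alpha\in A$, $o\in O$ put $$p(o\mid b,\alpha)=\sum_{s}O(o\mid s,\alpha)\sum_{s'}T(s\mid s',\alpha)b(s'),\qquad \tau(b,\alpha,o)(s)=\frac{O(o\mid s,\alpha)\sum_{s'}T(s\mid s',\alpha)b(s')}{p(o\mid b,\alpha)}\quad(p(o\mid b,\alpha)>0),$$ $$p(b'\mid b,\alpha)=\sum_{o:\,b'=\tau(b,\alpha,o)}p(o\mid b,\alpha),\qquad c(b,\alpha)=\sum_s c(s,\alpha)b(s).$$ A policy $\pi=(\pi_t)_{t\ge0}$ chooses $\alpha_t=\pi_t(b_0,o_1,\dots,o_t)\in A$. Under $\pi$, started at $b_0\in\Delta(S)$, the beliefs are $b_{t+1}=\tau(b_t,\alpha_t,o_{t+1})$, and $o_{t+1}$ has conditional law $p(\cdot\mid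 b_t,\alpha_t)$ given the past. Let $\mathcal F_t=\sigma(o_1,\dots,o_t)$, let $\mathcal C_t$ be the space of real $\mathcal F_t$-measurable random variables up to almost sure equality (each of them takes finitely many values), and let $c_t=c(b_t,\alpha_t)$. A policy is stationary if $\alpha_t=\mu(b_t)$ for all $t$, for one map $\mu:\Delta(S)\to A$. For every policy $\pi$ and every $b_0$ let one-step conditional risk measures $\rho_t=\rho_t^{\pi,b_0}:\mathcal C_{t+1}\to\mathcal C_t$, $t\ge0$, be given that are coherent: almost surely, - $\rho_t(\lambda Z+(1-\lambda)W)\le\lambda\rho_t(Z)+(1-\lambda)\rho_t(W)$ for $\lambda\in(0,1)$; - $Z\le W$ implies $\rho_t(Z)\le\rho_t(W)$; - $\rho_t(Y+Z)=Y+\rho_t(Z)$ for $Y\in\mathcal C_t$; - $\rho_t(\beta Z)=\beta\rho_t(Z)$ for real $\beta\ge0$. Suppose that they admit a Markov risk transition mapping: there is one mapping $\mathrm R$, independent of $t$, $\pi$ and $b_0$, which assigns a real number $\mathrm R\{v,b,m\}$ to every $v:\Delta(S)\to\mathbb R$, $b\in\Delta(S)$ and discrete probability distribution $m$ on $\Delta(S)$,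 such that for all $\pi$, $b_0$, $t$ and all $\varphi:\Delta(S)\times A\times\Delta(S)\to\mathbb R$, almost surely $$\rho_t\big(\varphi(b_t,\alpha_t,b_{t+1})\big)=\mathrm R\{\varphi(b_t,\alpha_t,\cdot),\,b_t,\,p(\cdot\mid b_t,\alpha_t)\}.$$ Let $\gamma\in(0,1)$ and define $$\rho^\gamma_{0,N}=\rho_0\Big(c_0+\rho_1\big(\gamma c_1+\cdots+\rho_{N-1}(\gamma^{N-1}c_{N-1}+\rho_N(\gamma^Nc_N))\cdots\big)\Big),\qquad V_\gamma(\pi,b_0)=\lim_{N\to\infty}\rho^\gamma_{0,N},\qquad V_\gamma(b)=\inf_\pi V_\gamma(\pi,b).$$ **Theorem.** 1. For every policy $\pi$ and every $b_0\in\Delta(S)$ the limit defining $V_\gamma(\pi,b_0)$ exists in $\mathbb R$. 2. The optimal risk value function $V_\gamma$ is bounded and solves the Bellman equation $$V_\gamma(b)=\min_{\alpha\in A}\Big(c(b,\alpha)+\gamma\,\mathrm R\{V_\gamma,\,b,\,p(\cdot\mid b,\alpha)\}\Big),\qquad b\in\Delta(S),$$ and it is the only bounded function on $\Delta(S)$ that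 solves it. 3. There is a stationary policy $\pi^*$ that is optimal among all policies, simultaneously for all initial beliefs: $V_\gamma(\pi^*,b)=V_\gamma(b)\le V_\gamma(\pi,b)$ for all $b\in\Delta(S)$ and all $\pi$. 4. A stationary policy, given by $\mu:\Delta(S)\to A$, is optimal for all initial beliefs if and only if $$\mu(b)\in\operatorname*{argmin}_{\alpha\in A}\Big(c(b,\alpha)+\gamma\,\mathrm R\{V_\gamma,\,b,\,p(\cdot\mid b,\alpha)\}\Big)\quad\text{for all } b\in\Delta(S).$$ -/

import Mathlib

open Filter Topology

/-- A finite POMDP with states `S`, actions `A` and observations `O`: the transition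
probabilities `T(s' | s, α) = trans s α s'`, the observation probabilities
`O(o | s, α) = obs s α o` (`s` is the state that has just been reached under the action `α`;
kernels `O(o | s)` are the special case without dependence on `α`), and a nonnegative cost.
The initial belief is not a field: it is an argument of everything that depends on it. -/
structure POMDP (S A O : Type*) [Fintype S] [Fintype O] where
  trans : S → A → S → ℝ
  trans_nonneg : ∀ s α s', 0 ≤ trans s α s'
  trans_sum : ∀ s α, ∑ s', trans s α s' = 1
  obs : S → A → O → ℝ
  obs_nonneg : ∀ s α o, 0 ≤ obs s α o
  obs_sum : ∀ s α, ∑ o, obs s α o = 1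
  cost : S → A → ℝ
  cost_nonneg : ∀ s α, 0 ≤ cost s α

/-- The belief simplex `Δ(S)`: the probability vectors over `S`. -/
abbrev Belief (S : Type*) [Fintype S] : Type _ := {b : S → ℝ // b ∈ stdSimplex ℝ S}

/-- A (deterministic, history-dependent) policy: the action at time `t` is a function of the
initial belief and of the observations `o₁, …, o_t` received so far. (Past actions and beliefs
are functions of these data and of the policy.) -/
abbrev Policy (S A O : Type*) [Fintype S] : Type _ :=
  (t : ℕ) → Belief S → (Fin t → O) → A

/-- One-step conditional risk mappings `ρ_t : C_{t+1} → C_t`, `t = 0, 1, …`. The σ-algebra `F_t`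
is the one generated by the first `t` observations. As there are finitely many of these, a random
variable in `C_t = L_p(F_t)` is just a real function of the length-`t` history, considered up to
histories of probability zero; the latter is taken care of in `POMDP.IsCoherent`. -/
abbrev OneStepRisk (O : Type*) : Type _ :=
  (t : ℕ) → ((Fin (t + 1) → O) → ℝ) → (Fin t → O) → ℝ

/-- The tail `ρ_t(γ^t c_t + ρ_{t+1}(γ^{t+1} c_{t+1} + ⋯ + ρ_N(γ^N c_N) ⋯))` of the discounted
nested risk, where `N = t + n`. -/
def nestedTail {O : Type*} (γ : ℝ) (ρ : OneStepRisk O) (c : (t : ℕ) → (Fin t → O) → ℝ) :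
    ℕ → (t : ℕ) → (Fin t → O) → ℝ
  | 0, t => ρ t (fun h => γ ^ t * c t (Fin.init h))
  | n + 1, t => ρ t (fun h => γ ^ t * c t (Fin.init h) + nestedTail γ ρ c n (t + 1) h)

namespace POMDP

variable {S A O : Type*} [Fintype S] [Fintype O]

/-- The predicted probability `∑_{s'} T(s | s', α) b(s')` of the next state `s`. -/
def pred (M : POMDP S A O) (b : Belief S) (α : A) (s : S) : ℝ :=
  ∑ s', M.trans s' α s * b.1 s'

/-- The probability `p(o | b, α) = ∑_s O(o | s, α) ∑_{s'} T(s | s', α) b(s')`. -/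
def obsProb (M : POMDP S A O) (b : Belief S) (α : A) (o : O) : ℝ :=
  ∑ s, M.obs s α o * M.pred b α s

theorem pred_nonneg (M : POMDP S A O) (b : Belief S) (α : A) (s : S) : 0 ≤ M.pred b α s :=
  Finset.sum_nonneg fun s' _ => mul_nonneg (M.trans_nonneg s' α s) (b.2.1 s')

theorem pred_sum (M : POMDP S A O) (b : Belief S) (α : A) : ∑ s, M.pred b α s = 1 := by
  unfold pred
  rw [Finset.sum_comm]
  simp_rw [← Finset.sum_mul, M.trans_sum, one_mul]
  exact b.2.2

theorem obsProb_nonneg (M : POMDP S A O) (b : Belief S) (α : A) (o : O) :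
    0 ≤ M.obsProb b α o :=
  Finset.sum_nonneg fun s _ => mul_nonneg (M.obs_nonneg s α o) (M.pred_nonneg b α s)

theorem obsProb_sum (M : POMDP S A O) (b : Belief S) (α : A) :
    ∑ o, M.obsProb b α o = 1 := by
  unfold obsProb
  rw [Finset.sum_comm]
  simp_rw [← Finset.sum_mul, M.obs_sum, one_mul]
  exact M.pred_sum b α

open Classical in
/-- The belief update (Bayes' law)
`b'(s) = O(o | s, α) ∑_{s'} T(s | s', α) b(s') / p(o | b, α)`.
For observations of probability zero the value is irrelevant, and set to `b`. -/
noncomputable def update (M : POMDP S A O) (b : Belief S) (α : A) (o : O) : Belief S :=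
  if h : M.obsProb b α o = 0 then b
  else ⟨fun s => M.obs s α o * M.pred b α s / M.obsProb b α o,
    fun s => div_nonneg (mul_nonneg (M.obs_nonneg s α o) (M.pred_nonneg b α s))
      (M.obsProb_nonneg b α o),
    by rw [← Finset.sum_div]; exact div_self h⟩

/-- The distribution `p(· | b, α)` of the next observation. -/
noncomputable def obsDist (M : POMDP S A O) (b : Belief S) (α : A) : PMF O :=
  PMF.ofFintype (fun o => ENNReal.ofReal (M.obsProb b α o)) (by
    rw [← ENNReal.ofReal_sum_of_nonneg (fun o _ => M.obsProb_nonneg b α o), M.obsProb_sum,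
      ENNReal.ofReal_one])

/-- The belief transition probability `p(b' | b, α) = ∑_o 1[b' = update(b, α, o)] p(o | b, α)`,
as a (finitely supported) probability distribution on the belief simplex. -/
noncomputable def beliefTrans (M : POMDP S A O) (b : Belief S) (α : A) : PMF (Belief S) :=
  (M.obsDist b α).map (M.update b α)

/-- The cost `c(b, α) = ∑_s c(s, α) b(s)` of a belief. -/
def beliefCost (M : POMDP S A O) (b : Belief S) (α : A) : ℝ :=
  ∑ s, M.cost s α * b.1 s

/-- The belief `b_t` under the policy `π`, started at `b₀`, after the observations `h`. -/
noncomputable def beliefAt (M : POMDP S A O) (π : Policy S A O) (b₀ : Belief S) :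
    (t : ℕ) → (Fin t → O) → Belief S
  | 0, _ => b₀
  | t + 1, h =>
      M.update (M.beliefAt π b₀ t (Fin.init h)) (π t b₀ (Fin.init h)) (h (Fin.last t))

/-- The probability of the observation history `h` under the policy `π`, started at `b₀`. -/
noncomputable def histProb (M : POMDP S A O) (π : Policy S A O) (b₀ : Belief S) :
    (t : ℕ) → (Fin t → O) → ℝ
  | 0, _ => 1
  | t + 1, h => M.histProb π b₀ t (Fin.init h) *
      M.obsProb (M.beliefAt π b₀ t (Fin.init h)) (π t b₀ (Fin.init h)) (h (Fin.last t))

/-- The stage cost `c_t = c(b_t, α_t)` under the policy `π`, started at `b₀`. -/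
noncomputable def stageCost (M : POMDP S A O) (π : Policy S A O) (b₀ : Belief S)
    (t : ℕ) (h : Fin t → O) : ℝ :=
  M.beliefCost (M.beliefAt π b₀ t h) (π t b₀ h)

/-- The belief at time `t` when the action `μ b` is used at every belief `b`. -/
noncomputable def stationaryBelief (M : POMDP S A O) (μ : Belief S → A) (b₀ : Belief S) :
    (t : ℕ) → (Fin t → O) → Belief S
  | 0, _ => b₀
  | t + 1, h => M.update (M.stationaryBelief μ b₀ t (Fin.init h))
      (μ (M.stationaryBelief μ b₀ t (Fin.init h))) (h (Fin.last t))

/-- The stationary (Markov) policy `α_t = μ(b_t)`. -/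
noncomputable def stationary (M : POMDP S A O) (μ : Belief S → A) : Policy S A O :=
  fun t b₀ h => μ (M.stationaryBelief μ b₀ t h)

theorem stationaryBelief_eq (M : POMDP S A O) (μ : Belief S → A) (b₀ : Belief S) (t : ℕ)
    (h : Fin t → O) : M.stationaryBelief μ b₀ t h = M.beliefAt (M.stationary μ) b₀ t h := by
  induction t with
  | zero => rfl
  | succ t ih => simp only [stationaryBelief, beliefAt, stationary, ← ih]

theorem stationary_apply (M : POMDP S A O) (μ : Belief S → A) (b₀ : Belief S) (t : ℕ)
    (h : Fin t → O) :
    M.stationary μ t b₀ h = μ (M.beliefAt (M.stationary μ) b₀ t h) := by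
  rw [← stationaryBelief_eq]; rfl

/-- The one-step conditional risk mappings `ρ_t` are coherent with respect to the probability of
observation histories under the policy `π`, started at `b₀`. All (in)equalities between random
variables are almost sure, that is, they hold at histories of positive probability. -/
structure IsCoherent (M : POMDP S A O) (π : Policy S A O) (b₀ : Belief S)
    (ρ : OneStepRisk O) : Prop where
  convex : ∀ (t : ℕ) (Z W : (Fin (t + 1) → O) → ℝ) (l : ℝ), 0 < l → l < 1 →
    ∀ h, 0 < M.histProb π b₀ t h →
      ρ t (fun x => l * Z x + (1 - l) * W x) h ≤ l * ρ t Z h + (1 - l) * ρ t W h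
  mono : ∀ (t : ℕ) (Z W : (Fin (t + 1) → O) → ℝ),
    (∀ x, 0 < M.histProb π b₀ (t + 1) x → Z x ≤ W x) →
    ∀ h, 0 < M.histProb π b₀ t h → ρ t Z h ≤ ρ t W h
  translation : ∀ (t : ℕ) (Y : (Fin t → O) → ℝ) (Z : (Fin (t + 1) → O) → ℝ),
    ∀ h, 0 < M.histProb π b₀ t h →
      ρ t (fun x => Y (Fin.init x) + Z x) h = Y h + ρ t Z h
  pos_homog : ∀ (t : ℕ) (Z : (Fin (t + 1) → O) → ℝ) (β : ℝ), 0 ≤ β →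
    ∀ h, 0 < M.histProb π b₀ t h → ρ t (fun x => β * Z x) h = β * ρ t Z h

/-- `R` is a Markov risk transition mapping of the `ρ_t` under the policy `π`, started at `b₀`:
almost surely, `ρ_t(φ(b_t, α_t, b_{t+1})) = R{φ(b_t, α_t, ·), b_t, p(· | b_t, α_t)}` for every
function `φ`. -/
def IsMarkovRisk (M : POMDP S A O) (π : Policy S A O) (b₀ : Belief S) (ρ : OneStepRisk O)
    (R : (Belief S → ℝ) → Belief S → PMF (Belief S) → ℝ) : Prop :=
  ∀ (t : ℕ) (φ : Belief S → A → Belief S → ℝ) (h : Fin t → O), 0 < M.histProb π b₀ t h →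
    ρ t (fun x => φ (M.beliefAt π b₀ t (Fin.init x)) (π t b₀ (Fin.init x))
        (M.beliefAt π b₀ (t + 1) x)) h =
      R (φ (M.beliefAt π b₀ t h) (π t b₀ h)) (M.beliefAt π b₀ t h)
        (M.beliefTrans (M.beliefAt π b₀ t h) (π t b₀ h))

/-- The discounted nested risk
`ρ^γ_{0,N} = ρ₀(c₀ + ρ₁(γ c₁ + ⋯ + ρ_{N-1}(γ^{N-1} c_{N-1} + ρ_N(γ^N c_N)) ⋯))` of the policy `π`
started at `b₀` (a number, as the history at time 0 is empty). -/
noncomputable def nestedRisk (M : POMDP S A O) (γ : ℝ)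
    (ρ : Policy S A O → Belief S → OneStepRisk O) (π : Policy S A O) (b₀ : Belief S)
    (N : ℕ) : ℝ :=
  nestedTail γ (ρ π b₀) (M.stageCost π b₀) N 0 Fin.elim0

/-- The total discounted risk `V_γ(π, b₀) = lim_{N → ∞} ρ^γ_{0,N}(c₀, …, c_N)`. -/
noncomputable def totalRisk (M : POMDP S A O) (γ : ℝ)
    (ρ : Policy S A O → Belief S → OneStepRisk O) (π : Policy S A O) (b₀ : Belief S) : ℝ :=
  limUnder atTop (M.nestedRisk γ ρ π b₀)

/-- The optimal risk value function `V_γ(b) = inf_π V_γ(π, b)`, over all policies. -/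
noncomputable def optimalValue (M : POMDP S A O) (γ : ℝ)
    (ρ : Policy S A O → Belief S → OneStepRisk O) (b : Belief S) : ℝ :=
  ⨅ π : Policy S A O, M.totalRisk γ ρ π b

/-- The right-hand side `c(b, α) + γ R{W, b, p(· | b, α)}` of the Bellman equation. -/
noncomputable def bellmanRHS (M : POMDP S A O) (γ : ℝ)
    (R : (Belief S → ℝ) → Belief S → PMF (Belief S) → ℝ) (W : Belief S → ℝ) (b : Belief S)
    (α : A) : ℝ :=
  M.beliefCost b α + γ * R W b (M.beliefTrans b α)

/-- `W` solves the Bellman equation `W(b) = min_α (c(b, α) + γ R{W, b, p(· | b, α)})` on `Δ(S)`. -/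
def SolvesBellman (M : POMDP S A O) (γ : ℝ)
    (R : (Belief S → ℝ) → Belief S → PMF (Belief S) → ℝ) (W : Belief S → ℝ) : Prop :=
  ∀ b, IsLeast (Set.range (M.bellmanRHS γ R W b)) (W b)

end POMDP

/-! Coherence passes from the `ρ_t` to `R`: applied to constant policies at time 0, it makes `R`
monotone and translation invariant at every transition law `p(· | b, α)`. Hence the Bellman
operator, and the evaluation operator of each stationary policy, is a sup-norm `γ`-contraction, and
Picard iteration gives each a bounded fixed point. Such a fixed point `W` is compared with nested
risks by unrolling. If `W` is at most the Bellman right-hand side along a policy, replacing `W`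
repeatedly by that side bounds it by the nested risk, up to an error `γ ^ (n + 1) * C` from the
missing terminal value; the reverse inequality works alike. In the limit, a Bellman solution lies
below the risk of every policy and equals the risk of its greedy stationary policy. So it is the
optimal value, which also gives uniqueness. The arguments are `risk_le_add`, `le_nestedTail` with
`nestedTail_le_add`, and `totalRisk_stationary`. -/

/-- A sup-norm `γ`-contraction on real functions, with `T 0` bounded, has a bounded fixed point. -/
theorem exists_bounded_fixedPoint {X : Type*} {γ K : ℝ} (hγ₀ : 0 ≤ γ) (hγ₁ : γ < 1)
    (T : (X → ℝ) → X → ℝ)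
    (hT : ∀ (V W : X → ℝ) (D : ℝ), (∀ x, |V x - W x| ≤ D) → ∀ x, |T V x - T W x| ≤ γ * D)
    (hK : ∀ x, |T 0 x| ≤ K) :
    ∃ W : X → ℝ, (∃ C, ∀ x, |W x| ≤ C) ∧ T W = W := by
  let u : ℕ → X → ℝ := fun n => T^[n] 0
  have hu : ∀ n, u (n + 1) = T (u n) := fun n => Function.iterate_succ_apply' T n 0
  have hstep : ∀ n x, dist (u n x) (u (n + 1) x) ≤ K * γ ^ n := by
    intro n
    induction n with
    | zero =>
      intro x
      simpa [u, dist_comm, Real.dist_eq] using hK x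
    | succ n ih =>
      intro x
      have := hT (u n) (u (n + 1)) (K * γ ^ n) ih x
      rw [← hu, ← hu] at this
      exact this.trans_eq (by ring)
  choose W hW using fun x =>
    cauchySeq_tendsto_of_complete (cauchySeq_of_le_geometric γ K hγ₁ (hstep · x))
  have hdist : ∀ n x, |u n x - W x| ≤ K * γ ^ n / (1 - γ) := fun n x =>
    dist_le_of_le_geometric_of_tendsto γ K hγ₁ (hstep · x) (hW x) n
  refine ⟨W, ⟨K / (1 - γ), fun x => ?_⟩, funext fun x => ?_⟩
  · simpa [u] using hdist 0 x
  · have hlim : Tendsto (fun n : ℕ => γ * (K * γ ^ n / (1 - γ))) atTop (𝓝 0) := by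
      have := ((tendsto_pow_atTop_nhds_zero_of_lt_one hγ₀ hγ₁).const_mul K).div_const (1 - γ)
      simpa using this.const_mul γ
    -- The contraction bound is uniform in the state, so it carries the convergence of the iterates
    -- through `T`.
    have h : Tendsto (fun n => u (n + 1) x) atTop (𝓝 (T W x)) := by
      rw [tendsto_iff_dist_tendsto_zero]
      refine squeeze_zero (fun _ => dist_nonneg) (fun n => ?_) hlim
      rw [hu]
      exact hT _ _ _ (hdist n) x
    exact tendsto_nhds_unique h ((hW x).comp (tendsto_add_atTop_nat 1))

namespace POMDP

variable {S A O : Type*} [Fintype S] [Fintype O]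

theorem beliefCost_nonneg (M : POMDP S A O) (b : Belief S) (α : A) : 0 ≤ M.beliefCost b α :=
  Finset.sum_nonneg fun s _ => mul_nonneg (M.cost_nonneg s α) (b.2.1 s)

theorem exists_beliefCost_le [Fintype A] (M : POMDP S A O) :
    ∃ K, 0 ≤ K ∧ ∀ b α, M.beliefCost b α ≤ K := by
  refine ⟨∑ s, ∑ α, M.cost s α,
    Finset.sum_nonneg fun s _ => Finset.sum_nonneg fun α _ => M.cost_nonneg s α, fun b α => ?_⟩
  refine Finset.sum_le_sum fun s _ => ?_
  have hb : b.1 s ≤ 1 := b.2.2 ▸ Finset.single_le_sum (fun s _ => b.2.1 s) (Finset.mem_univ s)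
  calc M.cost s α * b.1 s ≤ M.cost s α := mul_le_of_le_one_right (M.cost_nonneg s α) hb
    _ ≤ _ := Finset.single_le_sum (fun α _ => M.cost_nonneg s α) (Finset.mem_univ α)

/-! ### Nested risks of a fixed policy under coherence -/

namespace IsCoherent

variable {M : POMDP S A O} {π : Policy S A O} {b₀ : Belief S} {ρ : OneStepRisk O}

theorem map_zero (hρ : M.IsCoherent π b₀ ρ) {t : ℕ} {h : Fin t → O}
    (hh : 0 < M.histProb π b₀ t h) : ρ t (fun _ => 0) h = 0 := by
  simpa using hρ.pos_homog t (fun _ => 0) 0 le_rfl h hh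

theorem map_measurable (hρ : M.IsCoherent π b₀ ρ) {t : ℕ} (Y : (Fin t → O) → ℝ)
    {h : Fin t → O} (hh : 0 < M.histProb π b₀ t h) :
    ρ t (fun x => Y (Fin.init x)) h = Y h := by
  simpa [hρ.map_zero hh] using hρ.translation t Y (fun _ => 0) h hh

theorem nestedTail_zero (hρ : M.IsCoherent π b₀ ρ) (γ : ℝ) {t : ℕ} {h : Fin t → O}
    (hh : 0 < M.histProb π b₀ t h) :
    nestedTail γ ρ (M.stageCost π b₀) 0 t h = γ ^ t * M.stageCost π b₀ t h :=
  hρ.map_measurable (fun h => γ ^ t * M.stageCost π b₀ t h) hh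

theorem nestedTail_succ (hρ : M.IsCoherent π b₀ ρ) (γ : ℝ) (n : ℕ) {t : ℕ} {h : Fin t → O}
    (hh : 0 < M.histProb π b₀ t h) :
    nestedTail γ ρ (M.stageCost π b₀) (n + 1) t h = γ ^ t * M.stageCost π b₀ t h +
      ρ t (nestedTail γ ρ (M.stageCost π b₀) n (t + 1)) h :=
  hρ.translation t (fun h => γ ^ t * M.stageCost π b₀ t h) _ h hh

/-- A longer horizon only adds a nonnegative cost at the innermost position, and monotonicity
carries this outwards. -/
theorem nestedTail_le_succ (hρ : M.IsCoherent π b₀ ρ) {γ : ℝ} (hγ : 0 ≤ γ) (n : ℕ) :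
    ∀ {t : ℕ} {h : Fin t → O}, 0 < M.histProb π b₀ t h →
      nestedTail γ ρ (M.stageCost π b₀) n t h ≤
        nestedTail γ ρ (M.stageCost π b₀) (n + 1) t h := by
  induction n with
  | zero =>
    intro t h hh
    rw [hρ.nestedTail_zero γ hh, hρ.nestedTail_succ γ 0 hh, le_add_iff_nonneg_right,
      ← hρ.map_zero hh]
    refine hρ.mono t _ _ (fun x hx => ?_) h hh
    rw [hρ.nestedTail_zero γ hx]
    exact mul_nonneg (pow_nonneg hγ _) (M.beliefCost_nonneg _ _)
  | succ n ih =>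
    intro t h hh
    rw [hρ.nestedTail_succ γ n hh, hρ.nestedTail_succ γ (n + 1) hh]
    gcongr
    exact hρ.mono t _ _ (fun x hx => ih hx) h hh

theorem nestedTail_le (hρ : M.IsCoherent π b₀ ρ) {γ K : ℝ} (hγ : 0 ≤ γ) (hγ₁ : γ < 1)
    (hK₀ : 0 ≤ K) (hK : ∀ b α, M.beliefCost b α ≤ K) (n : ℕ) :
    ∀ {t : ℕ} {h : Fin t → O}, 0 < M.histProb π b₀ t h →
      nestedTail γ ρ (M.stageCost π b₀) n t h ≤ γ ^ t * (K / (1 - γ)) := by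
  have h1 : 0 < 1 - γ := sub_pos.2 hγ₁
  -- The geometric bound `K / (1 - γ)` is the fixed point of `x ↦ K + γ * x`, so it survives each
  -- unrolling.
  have hfix : K + γ * (K / (1 - γ)) = K / (1 - γ) := by field_simp; ring
  induction n with
  | zero =>
    intro t h hh
    rw [hρ.nestedTail_zero γ hh]
    have : 0 ≤ γ * (K / (1 - γ)) := by positivity
    refine mul_le_mul_of_nonneg_left ((hK _ _).trans ?_) (pow_nonneg hγ _)
    linarith
  | succ n ih =>
    intro t h hh
    rw [hρ.nestedTail_succ γ n hh]
    have hle : ρ t (nestedTail γ ρ (M.stageCost π b₀) n (t + 1)) h ≤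
        γ ^ (t + 1) * (K / (1 - γ)) :=
      (hρ.mono t _ (fun _ => γ ^ (t + 1) * (K / (1 - γ))) (fun x hx => ih hx) h hh).trans_eq
        (hρ.map_measurable (fun _ => γ ^ (t + 1) * (K / (1 - γ))) hh)
    calc _ ≤ γ ^ t * K + γ ^ (t + 1) * (K / (1 - γ)) :=
          add_le_add (mul_le_mul_of_nonneg_left (hK _ _) (pow_nonneg hγ _)) hle
      _ = γ ^ t * (K + γ * (K / (1 - γ))) := by ring
      _ = _ := by rw [hfix]

/-- The value of `ρ_t` at an affine function of the next belief. -/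
theorem map_affine_belief (hρ : M.IsCoherent π b₀ ρ)
    {R : (Belief S → ℝ) → Belief S → PMF (Belief S) → ℝ} (hR : M.IsMarkovRisk π b₀ ρ R)
    (W : Belief S → ℝ) (a : ℝ) {β : ℝ} (hβ : 0 ≤ β) {t : ℕ} {h : Fin t → O}
    (hh : 0 < M.histProb π b₀ t h) :
    ρ t (fun x => a + β * W (M.beliefAt π b₀ (t + 1) x)) h =
      a + β * R W (M.beliefAt π b₀ t h) (M.beliefTrans (M.beliefAt π b₀ t h) (π t b₀ h)) := by
  rw [← hR t (fun _ _ => W) h hh, ← hρ.pos_homog t _ β hβ h hh]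
  exact hρ.translation t (fun _ => a) (fun x => β * W (M.beliefAt π b₀ (t + 1) x)) h hh

end IsCoherent

/-! ### The risk transition mapping and Bellman operators -/

section Bellman

variable {M : POMDP S A O} {γ : ℝ} {ρ : Policy S A O → Belief S → OneStepRisk O}
  {R : (Belief S → ℝ) → Belief S → PMF (Belief S) → ℝ}

/-- Monotonicity and translation property that a risk transition mapping inherits from the
one-step risk measures of the constant policies. -/
theorem risk_le_add (hρ : ∀ π b₀, M.IsCoherent π b₀ (ρ π b₀))
    (hR : ∀ π b₀, M.IsMarkovRisk π b₀ (ρ π b₀) R) {V W : Belief S → ℝ} {D : ℝ}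
    (hVW : ∀ b, V b ≤ D + W b) (b : Belief S) (α : A) :
    R V b (M.beliefTrans b α) ≤ D + R W b (M.beliefTrans b α) := by
  -- The empty history has probability one, so starting at `b` with constant action `α` turns almost
  -- sure statements into statements about `R` at this very `b` and `α`.
  let π : Policy S A O := fun _ _ _ => α
  have hh : 0 < M.histProb π b 0 Fin.elim0 := one_pos
  have hV := (hρ π b).map_affine_belief (hR π b) V 0 zero_le_one hh
  have hW := (hρ π b).map_affine_belief (hR π b) W D zero_le_one hh
  have hle := (hρ π b).mono 0 (fun x => 0 + 1 * V (M.beliefAt π b (0 + 1) x))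
    (fun x => D + 1 * W (M.beliefAt π b (0 + 1) x))
    (fun x _ => by simpa using hVW _) Fin.elim0 hh
  rw [hV, hW, zero_add, one_mul, one_mul] at hle
  exact hle

theorem risk_zero (hρ : ∀ π b₀, M.IsCoherent π b₀ (ρ π b₀))
    (hR : ∀ π b₀, M.IsMarkovRisk π b₀ (ρ π b₀) R) (b : Belief S) (α : A) :
    R 0 b (M.beliefTrans b α) = 0 := by
  let π : Policy S A O := fun _ _ _ => α
  have hh : 0 < M.histProb π b 0 Fin.elim0 := one_pos
  rw [← (hρ π b).map_zero hh]
  exact (hR π b 0 (fun _ _ => 0) Fin.elim0 hh).symm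

theorem abs_risk_le (hρ : ∀ π b₀, M.IsCoherent π b₀ (ρ π b₀))
    (hR : ∀ π b₀, M.IsMarkovRisk π b₀ (ρ π b₀) R) {W : Belief S → ℝ} {C : ℝ}
    (hW : ∀ b, |W b| ≤ C) (b : Belief S) (α : A) : |R W b (M.beliefTrans b α)| ≤ C := by
  have h₁ := risk_le_add hρ hR (V := W) (W := 0) (D := C)
    (fun b => by simpa using (abs_le.1 (hW b)).2) b α
  have h₂ := risk_le_add hρ hR (V := 0) (W := W) (D := C)
    (fun b => by have := (abs_le.1 (hW b)).1; simp only [Pi.zero_apply]; linarith) b α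
  rw [risk_zero hρ hR] at h₁ h₂
  exact abs_le.2 ⟨by linarith, by linarith⟩

theorem bellmanRHS_le_add (hγ : 0 ≤ γ) (hρ : ∀ π b₀, M.IsCoherent π b₀ (ρ π b₀))
    (hR : ∀ π b₀, M.IsMarkovRisk π b₀ (ρ π b₀) R) {V W : Belief S → ℝ} {D : ℝ}
    (hVW : ∀ b, |V b - W b| ≤ D) (b : Belief S) (α : A) :
    M.bellmanRHS γ R V b α ≤ γ * D + M.bellmanRHS γ R W b α := by
  have h := mul_le_mul_of_nonneg_left
    (risk_le_add hρ hR (fun b => sub_le_iff_le_add.1 (abs_le.1 (hVW b)).2) b α) hγ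
  unfold bellmanRHS
  linarith

theorem abs_bellmanRHS_sub_le (hγ : 0 ≤ γ) (hρ : ∀ π b₀, M.IsCoherent π b₀ (ρ π b₀))
    (hR : ∀ π b₀, M.IsMarkovRisk π b₀ (ρ π b₀) R) {V W : Belief S → ℝ} {D : ℝ}
    (hVW : ∀ b, |V b - W b| ≤ D) (b : Belief S) (α : A) :
    |M.bellmanRHS γ R V b α - M.bellmanRHS γ R W b α| ≤ γ * D :=
  abs_sub_le_iff.2 ⟨sub_le_iff_le_add.2 (bellmanRHS_le_add hγ hρ hR hVW b α),
    sub_le_iff_le_add.2 (bellmanRHS_le_add hγ hρ hR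
      (fun b => (abs_sub_comm (W b) (V b)).trans_le (hVW b)) b α)⟩

theorem bellmanRHS_zero (hρ : ∀ π b₀, M.IsCoherent π b₀ (ρ π b₀))
    (hR : ∀ π b₀, M.IsMarkovRisk π b₀ (ρ π b₀) R) (b : Belief S) (α : A) :
    M.bellmanRHS γ R 0 b α = M.beliefCost b α := by
  rw [bellmanRHS, risk_zero hρ hR, mul_zero, add_zero]

theorem exists_solvesBellman [Fintype A] [Nonempty A] (hγ₀ : 0 ≤ γ) (hγ₁ : γ < 1)
    (hρ : ∀ π b₀, M.IsCoherent π b₀ (ρ π b₀)) (hR : ∀ π b₀, M.IsMarkovRisk π b₀ (ρ π b₀) R) :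
    ∃ W : Belief S → ℝ, (∃ C, ∀ b, |W b| ≤ C) ∧ M.SolvesBellman γ R W := by
  obtain ⟨K, -, hK⟩ := M.exists_beliefCost_le
  have hmin : ∀ W b, IsLeast (Set.range (M.bellmanRHS γ R W b)) (⨅ α, M.bellmanRHS γ R W b α) :=
    fun W b => ⟨exists_eq_ciInf_of_finite, Set.forall_mem_range.2
      (ciInf_le (Set.finite_range _).bddBelow)⟩
  have hle : ∀ (V W : Belief S → ℝ) (D : ℝ), (∀ b, |V b - W b| ≤ D) → ∀ b,
      (⨅ α, M.bellmanRHS γ R V b α) - (⨅ α, M.bellmanRHS γ R W b α) ≤ γ * D := by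
    intro V W D hVW b
    -- A minimizer for `W` is merely a candidate for `V`, so the actionwise bound passes to the
    -- minima.
    obtain ⟨α, hα⟩ := (hmin W b).1
    rw [← hα, sub_le_iff_le_add]
    exact ((hmin V b).2 ⟨α, rfl⟩).trans (bellmanRHS_le_add hγ₀ hρ hR hVW b α)
  obtain ⟨W, hC, hW⟩ := exists_bounded_fixedPoint (K := K) hγ₀ hγ₁
    (fun W b => ⨅ α, M.bellmanRHS γ R W b α)
    (fun V W D hVW b => abs_sub_le_iff.2 ⟨hle V W D hVW b,
      hle W V D (fun b => (abs_sub_comm (W b) (V b)).trans_le (hVW b)) b⟩)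
    (fun b => by
      obtain ⟨α, hα⟩ := (hmin 0 b).1
      rw [bellmanRHS_zero hρ hR] at hα
      rw [← hα, abs_of_nonneg (M.beliefCost_nonneg b α)]
      exact hK b α)
  exact ⟨W, hC, fun b => by rw [← congrFun hW b]; exact hW.symm ▸ hmin W b⟩

theorem exists_bellmanRHS_fixedPoint [Fintype A] (hγ₀ : 0 ≤ γ) (hγ₁ : γ < 1)
    (hρ : ∀ π b₀, M.IsCoherent π b₀ (ρ π b₀)) (hR : ∀ π b₀, M.IsMarkovRisk π b₀ (ρ π b₀) R)
    (μ : Belief S → A) :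
    ∃ W : Belief S → ℝ, (∃ C, ∀ b, |W b| ≤ C) ∧ ∀ b, M.bellmanRHS γ R W b (μ b) = W b := by
  obtain ⟨K, -, hK⟩ := M.exists_beliefCost_le
  obtain ⟨W, hC, hW⟩ := exists_bounded_fixedPoint (K := K) hγ₀ hγ₁
    (fun W b => M.bellmanRHS γ R W b (μ b))
    (fun V W D hVW b => abs_bellmanRHS_sub_le hγ₀ hρ hR hVW b (μ b))
    (fun b => by
      rw [bellmanRHS_zero hρ hR, abs_of_nonneg (M.beliefCost_nonneg b _)]
      exact hK b _)
  exact ⟨W, hC, congrFun hW⟩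

/-! ### Comparison of bounded functions with the total risk -/

theorem tendsto_nestedRisk [Fintype A] (hγ₀ : 0 ≤ γ) (hγ₁ : γ < 1)
    (hρ : ∀ π b₀, M.IsCoherent π b₀ (ρ π b₀)) (π : Policy S A O) (b₀ : Belief S) :
    Tendsto (M.nestedRisk γ ρ π b₀) atTop (𝓝 (M.totalRisk γ ρ π b₀)) := by
  obtain ⟨K, hK₀, hK⟩ := M.exists_beliefCost_le
  have hh : 0 < M.histProb π b₀ 0 Fin.elim0 := one_pos
  -- `limUnder` is meaningful only once some limit exists; here it is the supremum of a bounded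
  -- monotone sequence.
  refine tendsto_nhds_limUnder ⟨_, tendsto_atTop_ciSup
    (monotone_nat_of_le_succ fun n => (hρ π b₀).nestedTail_le_succ hγ₀ n hh)
    ⟨γ ^ 0 * (K / (1 - γ)), Set.forall_mem_range.2 fun n =>
      (hρ π b₀).nestedTail_le hγ₀ hγ₁ hK₀ hK n hh⟩⟩

/-- The tail contains `n + 1` costs but no terminal value; the omitted `W`, discounted `n + 1`
times, costs at most `γ ^ (n + 1) * C`. The induction peels off the first stage, hence the free `t`.
-/
theorem le_nestedTail (hγ₀ : 0 ≤ γ) (hρ : ∀ π b₀, M.IsCoherent π b₀ (ρ π b₀))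
    (hR : ∀ π b₀, M.IsMarkovRisk π b₀ (ρ π b₀) R) {W : Belief S → ℝ} {C : ℝ}
    (hC : ∀ b, |W b| ≤ C) {π : Policy S A O} {b₀ : Belief S}
    (hW : ∀ t h, W (M.beliefAt π b₀ t h) ≤
      M.bellmanRHS γ R W (M.beliefAt π b₀ t h) (π t b₀ h)) (n : ℕ) :
    ∀ {t : ℕ} {h : Fin t → O}, 0 < M.histProb π b₀ t h →
      γ ^ t * (W (M.beliefAt π b₀ t h) - γ ^ (n + 1) * C) ≤
        nestedTail γ (ρ π b₀) (M.stageCost π b₀) n t h := by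
  induction n with
  | zero =>
    intro t h hh
    rw [(hρ π b₀).nestedTail_zero γ hh]
    refine mul_le_mul_of_nonneg_left ?_ (pow_nonneg hγ₀ _)
    have h₁ := hW t h
    have h₂ := mul_le_mul_of_nonneg_left (abs_le.1 (abs_risk_le hρ hR hC
      (M.beliefAt π b₀ t h) (π t b₀ h))).2 hγ₀
    unfold bellmanRHS at h₁
    unfold stageCost
    rw [zero_add, pow_one]
    linarith
  | succ n ih =>
    intro t h hh
    rw [(hρ π b₀).nestedTail_succ γ n hh]
    -- The inductive bound is rearranged as an affine function of the next belief, the form in which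
    -- `ρ_t` can be expressed by `R`.
    have h₁ := (hρ π b₀).mono t
      (fun x => -(γ ^ (t + 1) * (γ ^ (n + 1) * C)) +
        γ ^ (t + 1) * W (M.beliefAt π b₀ (t + 1) x)) _
      (fun x hx => (by ring : _ = _).trans_le (ih hx)) h hh
    rw [(hρ π b₀).map_affine_belief (hR π b₀) W _ (pow_nonneg hγ₀ _) hh] at h₁
    have h₂ := mul_le_mul_of_nonneg_left (hW t h) (pow_nonneg hγ₀ t)
    unfold bellmanRHS at h₂
    unfold stageCost at h₁ ⊢
    ring_nf at h₁ h₂ ⊢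
    linarith

theorem nestedTail_le_add (hγ₀ : 0 ≤ γ) (hρ : ∀ π b₀, M.IsCoherent π b₀ (ρ π b₀))
    (hR : ∀ π b₀, M.IsMarkovRisk π b₀ (ρ π b₀) R) {W : Belief S → ℝ} {C : ℝ}
    (hC : ∀ b, |W b| ≤ C) {π : Policy S A O} {b₀ : Belief S}
    (hW : ∀ t h, M.bellmanRHS γ R W (M.beliefAt π b₀ t h) (π t b₀ h) ≤
      W (M.beliefAt π b₀ t h)) (n : ℕ) :
    ∀ {t : ℕ} {h : Fin t → O}, 0 < M.histProb π b₀ t h →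
      nestedTail γ (ρ π b₀) (M.stageCost π b₀) n t h ≤
        γ ^ t * (W (M.beliefAt π b₀ t h) + γ ^ (n + 1) * C) := by
  induction n with
  | zero =>
    intro t h hh
    rw [(hρ π b₀).nestedTail_zero γ hh]
    refine mul_le_mul_of_nonneg_left ?_ (pow_nonneg hγ₀ _)
    have h₁ := hW t h
    have h₂ := mul_le_mul_of_nonneg_left (abs_le.1 (abs_risk_le hρ hR hC
      (M.beliefAt π b₀ t h) (π t b₀ h))).1 hγ₀
    unfold bellmanRHS at h₁
    unfold stageCost
    rw [zero_add, pow_one]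
    linarith
  | succ n ih =>
    intro t h hh
    rw [(hρ π b₀).nestedTail_succ γ n hh]
    have h₁ := (hρ π b₀).mono t _
      (fun x => γ ^ (t + 1) * (γ ^ (n + 1) * C) +
        γ ^ (t + 1) * W (M.beliefAt π b₀ (t + 1) x))
      (fun x hx => (ih hx).trans_eq (by ring)) h hh
    rw [(hρ π b₀).map_affine_belief (hR π b₀) W _ (pow_nonneg hγ₀ _) hh] at h₁
    have h₂ := mul_le_mul_of_nonneg_left (hW t h) (pow_nonneg hγ₀ t)
    unfold bellmanRHS at h₂
    unfold stageCost at h₁ ⊢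
    ring_nf at h₁ h₂ ⊢
    linarith

theorem le_totalRisk [Fintype A] (hγ₀ : 0 ≤ γ) (hγ₁ : γ < 1)
    (hρ : ∀ π b₀, M.IsCoherent π b₀ (ρ π b₀)) (hR : ∀ π b₀, M.IsMarkovRisk π b₀ (ρ π b₀) R)
    {W : Belief S → ℝ} {C : ℝ} (hC : ∀ b, |W b| ≤ C) {π : Policy S A O} {b₀ : Belief S}
    (hW : ∀ t h, W (M.beliefAt π b₀ t h) ≤
      M.bellmanRHS γ R W (M.beliefAt π b₀ t h) (π t b₀ h)) :
    W b₀ ≤ M.totalRisk γ ρ π b₀ := by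
  have hlim : Tendsto (fun n : ℕ => W b₀ - γ ^ (n + 1) * C) atTop (𝓝 (W b₀)) := by
    simpa using ((((tendsto_pow_atTop_nhds_zero_of_lt_one hγ₀ hγ₁).comp
      (tendsto_add_atTop_nat 1)).mul_const C).const_sub (W b₀))
  refine le_of_tendsto_of_tendsto' hlim (tendsto_nestedRisk hγ₀ hγ₁ hρ π b₀) fun n => ?_
  simpa [beliefAt, nestedRisk] using
    le_nestedTail hγ₀ hρ hR hC hW n (t := 0) (h := Fin.elim0) one_pos

theorem totalRisk_le [Fintype A] (hγ₀ : 0 ≤ γ) (hγ₁ : γ < 1)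
    (hρ : ∀ π b₀, M.IsCoherent π b₀ (ρ π b₀)) (hR : ∀ π b₀, M.IsMarkovRisk π b₀ (ρ π b₀) R)
    {W : Belief S → ℝ} {C : ℝ} (hC : ∀ b, |W b| ≤ C) {π : Policy S A O} {b₀ : Belief S}
    (hW : ∀ t h, M.bellmanRHS γ R W (M.beliefAt π b₀ t h) (π t b₀ h) ≤
      W (M.beliefAt π b₀ t h)) :
    M.totalRisk γ ρ π b₀ ≤ W b₀ := by
  have hlim : Tendsto (fun n : ℕ => W b₀ + γ ^ (n + 1) * C) atTop (𝓝 (W b₀)) := by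
    simpa using ((((tendsto_pow_atTop_nhds_zero_of_lt_one hγ₀ hγ₁).comp
      (tendsto_add_atTop_nat 1)).mul_const C).const_add (W b₀))
  refine le_of_tendsto_of_tendsto' (tendsto_nestedRisk hγ₀ hγ₁ hρ π b₀) hlim fun n => ?_
  simpa [beliefAt, nestedRisk] using
    nestedTail_le_add hγ₀ hρ hR hC hW n (t := 0) (h := Fin.elim0) one_pos

/-- The total risk of a stationary policy is the bounded solution of its evaluation equation. -/
theorem totalRisk_stationary [Fintype A] (hγ₀ : 0 ≤ γ) (hγ₁ : γ < 1)
    (hρ : ∀ π b₀, M.IsCoherent π b₀ (ρ π b₀)) (hR : ∀ π b₀, M.IsMarkovRisk π b₀ (ρ π b₀) R)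
    {W : Belief S → ℝ} {C : ℝ} (hC : ∀ b, |W b| ≤ C) {μ : Belief S → A}
    (hW : ∀ b, M.bellmanRHS γ R W b (μ b) = W b) (b : Belief S) :
    M.totalRisk γ ρ (M.stationary μ) b = W b := by
  apply le_antisymm
  · refine totalRisk_le hγ₀ hγ₁ hρ hR hC fun t h => ?_
    rw [stationary_apply, hW]
  · refine le_totalRisk hγ₀ hγ₁ hρ hR hC fun t h => ?_
    rw [stationary_apply, hW]

theorem SolvesBellman.exists_selector {W : Belief S → ℝ} (hW : M.SolvesBellman γ R W) :
    ∃ μ : Belief S → A, ∀ b, M.bellmanRHS γ R W b (μ b) = W b :=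
  ⟨fun b => (hW b).1.choose, fun b => (hW b).1.choose_spec⟩

theorem SolvesBellman.le_totalRisk [Fintype A] {W : Belief S → ℝ} (hW : M.SolvesBellman γ R W)
    (hγ₀ : 0 ≤ γ) (hγ₁ : γ < 1) (hρ : ∀ π b₀, M.IsCoherent π b₀ (ρ π b₀))
    (hR : ∀ π b₀, M.IsMarkovRisk π b₀ (ρ π b₀) R) {C : ℝ} (hC : ∀ b, |W b| ≤ C)
    (π : Policy S A O) (b : Belief S) : W b ≤ M.totalRisk γ ρ π b :=
  POMDP.le_totalRisk hγ₀ hγ₁ hρ hR hC fun _ _ => (hW _).2 ⟨_, rfl⟩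

/-- A bounded solution of the Bellman equation is the optimal value function. -/
theorem SolvesBellman.eq_optimalValue [Fintype A] {W : Belief S → ℝ}
    (hW : M.SolvesBellman γ R W) (hγ₀ : 0 ≤ γ) (hγ₁ : γ < 1)
    (hρ : ∀ π b₀, M.IsCoherent π b₀ (ρ π b₀)) (hR : ∀ π b₀, M.IsMarkovRisk π b₀ (ρ π b₀) R)
    {C : ℝ} (hC : ∀ b, |W b| ≤ C) : W = M.optimalValue γ ρ := by
  obtain ⟨μ, hμ⟩ := hW.exists_selector
  funext b
  -- The infimum is attained by the greedy policy, so no default value of the real infimum can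
  -- intervene.
  have hleast : IsLeast (Set.range fun π => M.totalRisk γ ρ π b) (W b) :=
    ⟨⟨M.stationary μ, totalRisk_stationary hγ₀ hγ₁ hρ hR hC hμ b⟩,
      Set.forall_mem_range.2 fun π => hW.le_totalRisk hγ₀ hγ₁ hρ hR hC π b⟩
  exact hleast.csInf_eq.symm

end Bellman

end POMDP

/-! ### Optimality and the characterization of stationary optimal policies -/

theorem mainTheorem1 {S A O : Type*} [Fintype S] [Fintype A] [Nonempty A] [Fintype O]
    (M : POMDP S A O) (γ : ℝ) (hγ₀ : 0 < γ) (hγ₁ : γ < 1)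
    (ρ : Policy S A O → Belief S → OneStepRisk O)
    (hρ : ∀ π b₀, M.IsCoherent π b₀ (ρ π b₀))
    (R : (Belief S → ℝ) → Belief S → PMF (Belief S) → ℝ)
    (hR : ∀ π b₀, M.IsMarkovRisk π b₀ (ρ π b₀) R) :
    -- the objective is well defined: the limit of the nested risks exists
    (∀ π b₀, Tendsto (M.nestedRisk γ ρ π b₀) atTop (𝓝 (M.totalRisk γ ρ π b₀))) ∧
    -- the optimal value function is the unique bounded solution of the Bellman equation
    M.SolvesBellman γ R (M.optimalValue γ ρ) ∧
    (∃ C, ∀ b, |M.optimalValue γ ρ b| ≤ C) ∧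
    (∀ W : Belief S → ℝ, (∃ C, ∀ b, |W b| ≤ C) → M.SolvesBellman γ R W →
      W = M.optimalValue γ ρ) ∧
    -- there is a stationary policy that is optimal among all policies, from every belief
    (∃ μ : Belief S → A, ∀ b,
      M.totalRisk γ ρ (M.stationary μ) b = M.optimalValue γ ρ b ∧
      ∀ π, M.totalRisk γ ρ (M.stationary μ) b ≤ M.totalRisk γ ρ π b) ∧
    -- a stationary policy is optimal iff it selects minimizers in the Bellman equation
    (∀ μ : Belief S → A,
      (∀ b π, M.totalRisk γ ρ (M.stationary μ) b ≤ M.totalRisk γ ρ π b) ↔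
      (∀ b, IsMinOn (M.bellmanRHS γ R (M.optimalValue γ ρ) b) Set.univ (μ b))) := by
  obtain ⟨W, ⟨C, hC⟩, hW⟩ := POMDP.exists_solvesBellman hγ₀.le hγ₁ hρ hR
  rw [← hW.eq_optimalValue hγ₀.le hγ₁ hρ hR hC]
  obtain ⟨μ', hμ'⟩ := hW.exists_selector
  have hopt := POMDP.totalRisk_stationary hγ₀.le hγ₁ hρ hR hC hμ'
  have hle := hW.le_totalRisk hγ₀.le hγ₁ hρ hR hC
  refine ⟨POMDP.tendsto_nestedRisk hγ₀.le hγ₁ hρ, hW, ⟨C, hC⟩, ?_,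
    ⟨μ', fun b => ⟨hopt b, fun π => (hopt b).trans_le (hle π b)⟩⟩, fun μ => ⟨fun h b => ?_,
      fun h b π => ?_⟩⟩
  · rintro V ⟨D, hD⟩ hV
    rw [hV.eq_optimalValue hγ₀.le hγ₁ hρ hR hD, hW.eq_optimalValue hγ₀.le hγ₁ hρ hR hC]
  -- The evaluation fixed point `V` of `μ` is its total risk; optimality forces `V = W`, so the
  -- evaluation equation says that `μ` attains the Bellman minimum.
  · obtain ⟨V, ⟨D, hD⟩, hV⟩ := POMDP.exists_bellmanRHS_fixedPoint hγ₀.le hγ₁ hρ hR μ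
    have hVW : V = W := funext fun b => by
      rw [← POMDP.totalRisk_stationary hγ₀.le hγ₁ hρ hR hD hV b]
      exact le_antisymm ((h b _).trans_eq (hopt b)) (hle _ b)
    subst hVW
    exact isMinOn_univ_iff.2 fun α => (hV b).trans_le ((hW b).2 ⟨α, rfl⟩)
  · have hμ : ∀ b, M.bellmanRHS γ R W b (μ b) = W b := fun b =>
      le_antisymm ((isMinOn_univ_iff.1 (h b) (μ' b)).trans_eq (hμ' b)) ((hW b).2 ⟨_, rfl⟩)
    exact (POMDP.totalRisk_stationary hγ₀.le hγ₁ hρ hR hC hμ b).trans_le (hle π b)
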